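/- Let $H_1,H_2$ be separable complex Hilbert spaces with inner products linear in the first variable, $H_1\otimes H_2$ their Hilbert space tensor product, and $(X_1,\mu_1),(X_2,\mu_2)$ measure spaces with $\sigma$-finite positive measures. A map $F:X\to H$ from a measure space $(X,\mu)$ to a Hilbert space $H$ is a *Bessel mapping* if $x\mapsto\langle f,F(x)\rangle$ is measurable for every $f\in H$ and there is $B<\infty$ with $\int_X|\langle f,F(x)\rangle|^2\,d\mu(x)\le B\|f\|^2$ for all $f\in H$; it is a *continuous frame* if moreover, for some $A>0$, $A\|f\|^2\le\int_X|\langle f,F(x)\rangle|^2\,d\mu(x)$ for all $f\in H$. For measurable $m:X\to\mathbb C$ and $F,G:X\to H$, write $\mathbf M_{m,F,G}$ for the bounded operator on $H$ with $$\langle \mathbf M_{m,F,G}f,g\rangle=\int_X m(x)\langle f,F(x)\rangle\langle G(x),g\rangle\,d\mu(x)\qquad(f,g\in H);$$ it exists if all these integrals converge absolutely and are represented by a bounded operator. It is called a *continuous Bessel multiplier* if $F,G$ are Bessel mappings and a *continuous frame multiplier* if $F,G$ are continuous frames. An operator is *trace class* if it is compact with summable singular values. The *partial trace* $T(A)$ of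 a trace class operator $A$ on $H_1\otimes H_2$ with respect to $H_1$ is the operator on $H_1$ with $\langle T(A)f,g\rangle=\sum_i\langle A(f\otimes e_i),g\otimes e_i\rangle$ for all $f,g\in H_1$ and every orthonormal basis $(e_i)$ of $H_2$; the partial trace with respect to $H_2$ is defined in the same way with the factors exchanged. **Corollary 5.7.** For $j=1,2$ let $m_j:X_j\to\mathbb C$ be measurable and let $F_j,G_j:X_j\to H_j$ be Bessel mappings. Put $m(x_1,x_2)=m_1(x_1)m_2(x_2)$, $F(x_1,x_2)=F_1(x_1)\otimes F_2(x_2)$ and $G(x_1,x_2)=G_1(x_1)\otimes G_2(x_2)$ on $(X_1\times X_2,\mu_1\otimes\mu_2)$, and suppose that $\mathbf M_{m,F,G}$ exists and is trace class on $H_1\otimes H_2$. 1. If $\mathbf M_{m,F,G}\ne0$, then $\mathbf M_{m_1,F_1,G_1}$ and $\mathbf M_{m_2,F_2,G_2}$ exist and are trace class. 2. Whenever $\mathbf M_{m_1,F_1,G_1}$ and $\mathbf M_{m_2,F_2,G_2}$ exist, $\mathbf M_{m,F,G}=\mathbf M_{m_1,F_1,G_1}\otimes\mathbf M_{m_2,F_2,G_2}$,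 and the partial trace of $\mathbf M_{m,F,G}$ with respect to $H_1$ is $$\mathrm{Tr}_{H_2}(\mathbf M_{m_2,F_2,G_2})\,\mathbf M_{m_1,F_1,G_1}.$$ Here $\mathbf M_{m_2,F_2,G_2}$ is trace class unless $\mathbf M_{m_1,F_1,G_1}=0$, in which case the product is read as $0$. This partial trace is a trace class operator, and it is the continuous Bessel multiplier of $F_1$ and $G_1$ with symbol $\mathrm{Tr}_{H_2}(\mathbf M_{m_2,F_2,G_2})\,m_1$ (if the trace is undefined, any constant may be taken in its place); it is a continuous frame multiplier if $F_1,G_1$ are continuous frames. Likewise, with the roles of the two factors exchanged, the partial trace of $\mathbf M_{m,F,G}$ with respect to $H_2$ is $\mathrm{Tr}_{H_1}(\mathbf M_{m_1,F_1,G_1})\,\mathbf M_{m_2,F_2,G_2}$. -/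

import Mathlib

open MeasureTheory UniformSpace
open scoped TensorProduct InnerProductSpace ENNReal NNReal

/-- The Hilbert space tensor product: the completion of the algebraic tensor product with respect
to the inner product determined by `⟪x₁ ⊗ y₁, x₂ ⊗ y₂⟫ = ⟪x₁, x₂⟫ * ⟪y₁, y₂⟫`. -/
abbrev HilbertTensor (H₁ H₂ : Type*) [NormedAddCommGroup H₁] [InnerProductSpace ℂ H₁]
    [NormedAddCommGroup H₂] [InnerProductSpace ℂ H₂] : Type _ :=
  Completion (H₁ ⊗[ℂ] H₂)

section Tensors

variable {H₁ H₂ : Type*} [NormedAddCommGroup H₁] [InnerProductSpace ℂ H₁]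
  [NormedAddCommGroup H₂] [InnerProductSpace ℂ H₂]

/-- The simple tensor `x ⊗ y` in the Hilbert space tensor product. -/
noncomputable def simpleTensor (x : H₁) (y : H₂) : HilbertTensor H₁ H₂ :=
  ((x ⊗ₜ[ℂ] y : H₁ ⊗[ℂ] H₂) : Completion (H₁ ⊗[ℂ] H₂))

/-- The tensor product `S ⊗ T` of bounded operators, i.e. the bounded operator with
`(S ⊗ T) (x ⊗ y) = S x ⊗ T y`. -/
noncomputable def tensorOperator (S : H₁ →L[ℂ] H₁) (T : H₂ →L[ℂ] H₂) :
    HilbertTensor H₁ H₂ →L[ℂ] HilbertTensor H₁ H₂ :=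
  (TensorProduct.mapL S T).completion

/-- The tensor product `F₁ ⊗ F₂` of vector-valued mappings, `(x₁, x₂) ↦ F₁ x₁ ⊗ F₂ x₂`. -/
noncomputable def tensorMapping {X₁ X₂ : Type*} (F₁ : X₁ → H₁) (F₂ : X₂ → H₂) :
    X₁ × X₂ → HilbertTensor H₁ H₂ :=
  fun x => simpleTensor (F₁ x.1) (F₂ x.2)

end Tensors

section Frames

variable {X H : Type*} [MeasurableSpace X] [NormedAddCommGroup H] [InnerProductSpace ℂ H]

/-- `F` is weakly measurable: `x ↦ ⟨f, F x⟩` is measurable for every `f`. (Mathlib's inner product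
is linear in the second variable, so the paper's `⟨f, g⟩` is `⟪g, f⟫_ℂ`.) -/
def WeaklyMeasurable (F : X → H) : Prop :=
  ∀ f : H, Measurable fun x => ⟪F x, f⟫_ℂ

/-- Continuous Bessel mappings:
`F` is weakly measurable and `∫ |⟨f, F x⟩|² dμ ≤ B ‖f‖²` for all `f`, for some `B < ∞`. -/
def IsBesselMapping (μ : Measure X) (F : X → H) : Prop :=
  WeaklyMeasurable F ∧
    ∃ B : ℝ≥0, ∀ f : H, ∫⁻ x, ‖⟪F x, f⟫_ℂ‖ₑ ^ 2 ∂μ ≤ B * ‖f‖ₑ ^ 2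

/-- Continuous frames: weakly measurable, with
`A ‖f‖² ≤ ∫ |⟨f, F x⟩|² dμ ≤ B ‖f‖²` for all `f`, for some `A > 0` and `B < ∞`. -/
def IsContinuousFrame (μ : Measure X) (F : X → H) : Prop :=
  WeaklyMeasurable F ∧
    ∃ A B : ℝ≥0, 0 < A ∧ ∀ f : H,
      A * ‖f‖ₑ ^ 2 ≤ ∫⁻ x, ‖⟪F x, f⟫_ℂ‖ₑ ^ 2 ∂μ ∧
      ∫⁻ x, ‖⟪F x, f⟫_ℂ‖ₑ ^ 2 ∂μ ≤ B * ‖f‖ₑ ^ 2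

/-- The bounded operator `M` is weakly defined by
`⟨M f, g⟩ = ∫ m(x) ⟨f, F x⟩ ⟨G x, g⟩ dμ(x)` for all `f`, `g`, where all the integrals
exist (converge absolutely). -/
def IsWeaklyGivenBy (μ : Measure X) (m : X → ℂ) (F G : X → H) (M : H →L[ℂ] H) : Prop :=
  ∀ f g : H, Integrable (fun x => m x * ⟪F x, f⟫_ℂ * ⟪g, G x⟫_ℂ) μ ∧
    ⟪g, M f⟫_ℂ = ∫ x, m x * ⟪F x, f⟫_ℂ * ⟪g, G x⟫_ℂ ∂μ

/-- `M` is the continuous Bessel multiplier of `F` and `G` with symbol `m`. -/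
structure IsBesselMultiplier (μ : Measure X) (m : X → ℂ) (F G : X → H) (M : H →L[ℂ] H) :
    Prop where
  measurable_symbol : Measurable m
  bessel_left : IsBesselMapping μ F
  bessel_right : IsBesselMapping μ G
  weaklyGivenBy : IsWeaklyGivenBy μ m F G M

/-- `M` is the continuous frame multiplier of `F` and `G` with symbol `m`. -/
structure IsFrameMultiplier (μ : Measure X) (m : X → ℂ) (F G : X → H) (M : H →L[ℂ] H) :
    Prop where
  measurable_symbol : Measurable m
  frame_left : IsContinuousFrame μ F
  frame_right : IsContinuousFrame μ G
  weaklyGivenBy : IsWeaklyGivenBy μ m F G M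

end Frames

section Trace

variable {H : Type*} [NormedAddCommGroup H] [InnerProductSpace ℂ H]

/-- Trace class operators: `A` is compact and its singular values are summable. Here `b` is an
orthonormal basis of eigenvectors of `A* A` with eigenvalues `s i ^ 2`, `s i ≥ 0`; so the `s i` are
the eigenvalues of the positive square root of `A* A`, repeated according to multiplicity, i.e. the
singular values of `A`. (Every orthonormal basis can be indexed by its own range, a subset
of `H`.) -/
def IsTraceClass [CompleteSpace H] (A : H →L[ℂ] H) : Prop :=
  IsCompactOperator A ∧
    ∃ (w : Set H) (b : HilbertBasis w ℂ H) (s : w → ℝ),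
      (∀ i, 0 ≤ s i) ∧
      (∀ i, (ContinuousLinearMap.adjoint A) (A (b i)) = ((s i ^ 2 : ℝ) : ℂ) • b i) ∧
      Summable s

/-- `∑ ⟨A eᵢ, eᵢ⟩ = c` for every orthonormal basis `(eᵢ)` of `H`. -/
def HasTrace (A : H →L[ℂ] H) (c : ℂ) : Prop :=
  ∀ (w : Set H) (e : HilbertBasis w ℂ H), HasSum (fun i => ⟪e i, A (e i)⟫_ℂ) c

open Classical in
/-- The trace `Tr A`: the common value of the sums `∑ ⟨A eᵢ, eᵢ⟩` over all orthonormal bases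
(`0` if there is no such common value, which does not happen for trace class operators). -/
noncomputable def operatorTrace (A : H →L[ℂ] H) : ℂ :=
  if h : ∃ c, HasTrace A c then h.choose else 0

end Trace

section PartialTrace

variable {H₁ H₂ : Type*} [NormedAddCommGroup H₁] [InnerProductSpace ℂ H₁]
  [NormedAddCommGroup H₂] [InnerProductSpace ℂ H₂]

/-- `T` is the partial trace of `A` with respect to `H₁` (the second factor is traced out):
`⟨T f, g⟩ = ∑ ⟨A (f ⊗ eᵢ), g ⊗ eᵢ⟩` for all `f`, `g` and every orthonormal basis `(eᵢ)` of `H₂`. -/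
def IsPartialTraceFst (A : HilbertTensor H₁ H₂ →L[ℂ] HilbertTensor H₁ H₂)
    (T : H₁ →L[ℂ] H₁) : Prop :=
  ∀ (w : Set H₂) (e : HilbertBasis w ℂ H₂) (f g : H₁),
    HasSum (fun i => ⟪simpleTensor g (e i), A (simpleTensor f (e i))⟫_ℂ) ⟪g, T f⟫_ℂ

/-- `T` is the partial trace of `A` with respect to `H₂` (the first factor is traced out):
`⟨T f, g⟩ = ∑ ⟨A (eᵢ ⊗ f), eᵢ ⊗ g⟩` for all `f`, `g` and every orthonormal basis `(eᵢ)` of `H₁`. -/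
def IsPartialTraceSnd (A : HilbertTensor H₁ H₂ →L[ℂ] HilbertTensor H₁ H₂)
    (T : H₂ →L[ℂ] H₂) : Prop :=
  ∀ (w : Set H₁) (e : HilbertBasis w ℂ H₁) (f g : H₂),
    HasSum (fun i => ⟪simpleTensor (e i) g, A (simpleTensor (e i) f)⟫_ℂ) ⟪g, T f⟫_ℂ

/-- The partial trace with respect to `H₁` is unique. -/
theorem IsPartialTraceFst.unique [CompleteSpace H₂]
    {A : HilbertTensor H₁ H₂ →L[ℂ] HilbertTensor H₁ H₂} {T T' : H₁ →L[ℂ] H₁}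
    (h : IsPartialTraceFst A T) (h' : IsPartialTraceFst A T') : T = T' := by
  obtain ⟨w, e, -⟩ := exists_hilbertBasis ℂ H₂
  ext f
  exact ext_inner_left ℂ fun g => (h w e f g).unique (h' w e f g)

/-- The partial trace with respect to `H₂` is unique. -/
theorem IsPartialTraceSnd.unique [CompleteSpace H₁]
    {A : HilbertTensor H₁ H₂ →L[ℂ] HilbertTensor H₁ H₂} {T T' : H₂ →L[ℂ] H₂}
    (h : IsPartialTraceSnd A T) (h' : IsPartialTraceSnd A T') : T = T' := by
  obtain ⟨w, e, -⟩ := exists_hilbertBasis ℂ H₁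
  ext f
  exact ext_inner_left ℂ fun g => (h w e f g).unique (h' w e f g)

end PartialTrace

-- At simple tensors the integrand of `M` factorizes, so by Fubini each matrix entry of `M` is a
-- product of an integral over `X₁` and one over `X₂` (`inner_tensor`). Simple tensors span a dense
-- subspace, hence `M ≠ 0` forces some entry, and both its factors, to be nonzero. Freezing the
-- vectors of one factor exhibits the other multiplier as a nonzero scalar times a compression `U* M
-- V`, with `U`, `V` of the form `x ↦ x ⊗ y`; this yields existence, boundedness and, by the ideal
-- property (`IsTraceClass.adjoint_comp_comp`), trace class. Comparing entries gives `M = M₁ ⊗ M₂`,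
-- and the partial trace is read off from `⟪g, M₁ f⟫ * ∑ ⟪eᵢ, M₂ eᵢ⟫`.
--
-- The ideal property and the basis independence of the trace are derived from singular values: a
-- singular basis has `∑ ‖A bₖ‖ < ∞`, which makes the relevant double series converge absolutely.

universe u

/-! ### Bessel-type bounds for pairs of orthonormal families -/

section Orthonormal

variable {H : Type*} [NormedAddCommGroup H] [InnerProductSpace ℂ H]

/-- Cauchy–Schwarz, then Bessel's inequality for each family. -/
theorem Orthonormal.sum_norm_inner_mul_norm_inner_le {ι : Type*} {u v : ι → H}
    (hu : Orthonormal ℂ u) (hv : Orthonormal ℂ v) (x y : H) (t : Finset ι) :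
    ∑ i ∈ t, ‖⟪v i, x⟫_ℂ‖ * ‖⟪u i, y⟫_ℂ‖ ≤ ‖x‖ * ‖y‖ := by
  refine (Real.sum_mul_le_sqrt_mul_sqrt t _ _).trans ?_
  gcongr
  · exact Real.sqrt_le_iff.2 ⟨norm_nonneg _, hv.sum_inner_products_le x⟩
  · exact Real.sqrt_le_iff.2 ⟨norm_nonneg _, hu.sum_inner_products_le y⟩

theorem Orthonormal.summable_norm_inner_mul_norm_inner {ι : Type*} {u v : ι → H}
    (hu : Orthonormal ℂ u) (hv : Orthonormal ℂ v) (x y : H) :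
    Summable fun i => ‖⟪v i, x⟫_ℂ‖ * ‖⟪u i, y⟫_ℂ‖ :=
  summable_of_sum_le (fun _ => by positivity) (hu.sum_norm_inner_mul_norm_inner_le hv x y)

theorem Orthonormal.tsum_norm_inner_mul_norm_inner_le {ι : Type*} {u v : ι → H}
    (hu : Orthonormal ℂ u) (hv : Orthonormal ℂ v) (x y : H) :
    ∑' i, ‖⟪v i, x⟫_ℂ‖ * ‖⟪u i, y⟫_ℂ‖ ≤ ‖x‖ * ‖y‖ :=
  (hu.summable_norm_inner_mul_norm_inner hv x y).tsum_le_of_sum_le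
    (hu.sum_norm_inner_mul_norm_inner_le hv x y)

end Orthonormal

/-! ### Eigenbases of compact self-adjoint operators -/

section Spectral

variable {H : Type*} [NormedAddCommGroup H] [InnerProductSpace ℂ H] [CompleteSpace H]

/-- A compact self-adjoint operator admits a Hilbert basis of eigenvectors. -/
theorem IsCompactOperator.exists_hilbertBasis_eigenvectors {T : H →L[ℂ] H}
    (hT : IsCompactOperator T) (hT' : (T : H →ₗ[ℂ] H).IsSymmetric) :
    ∃ (w : Set H) (b : HilbertBasis w ℂ H), ∀ i, ∃ c : ℂ, T (b i) = c • b i := by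
  set E : ℂ → Submodule ℂ H := fun c => Module.End.eigenspace (T : H →ₗ[ℂ] H) c with hE
  have hclosed (c : ℂ) : IsClosed (E c : Set H) := by
    have : (E c : Set H) = {x | T x = c • x} := by
      ext x; simp [hE]
    rw [this]
    exact isClosed_eq T.continuous (continuous_const_smul c)
  have (c : ℂ) : CompleteSpace (E c) := (hclosed c).completeSpace_coe
  choose w b hb using fun c : ℂ => exists_hilbertBasis ℂ (E c)
  have hon : Orthonormal ℂ fun a : Σ c, w c => ((b a.1 a.2 : E a.1) : H) :=
    hT'.orthogonalFamily_eigenspaces.orthonormal_sigma_orthonormal fun c => (b c).orthonormal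
  have hrange := hon.toSubtypeRange
  refine ⟨_, HilbertBasis.mkOfOrthogonalEqBot hrange ?_, ?_⟩
  · rw [Subtype.range_coe, Submodule.eq_bot_iff]
    intro v hv
    -- Orthogonality to the basis of each eigenspace passes to the whole eigenspace by expanding
    -- `x`.
    have hv' (c : ℂ) (x : E c) : ⟪v, x⟫_ℂ = 0 := by
      have h := ((b c).hasSum_repr x).mapL ((innerSL ℂ v).comp (E c).subtypeL)
      refine h.unique ?_
      convert! hasSum_zero with i
      have : ⟪v, (b c i : H)⟫_ℂ = 0 :=
        (Submodule.mem_orthogonal' _ _).1 hv _ (Submodule.subset_span ⟨⟨c, i⟩, rfl⟩)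
      simp [this]
    have hmem : v ∈ (⨆ c, E c)ᗮ := by
      rw [← Submodule.iInf_orthogonal, Submodule.mem_iInf]
      exact fun c => (Submodule.mem_orthogonal' _ _).2 fun x hx => hv' c ⟨x, hx⟩
    have hbot : (⨆ c, E c)ᗮ = ⊥ :=
      ContinuousLinearMap.orthogonalComplement_iSup_eigenspaces_eq_bot hT hT'
    rwa [hbot, Submodule.mem_bot] at hmem
  · rintro ⟨_, ⟨c, i⟩, rfl⟩
    refine ⟨c, ?_⟩
    simpa using Module.End.mem_eigenspace_iff.1 (b c i).2

end Spectral

/-! ### Trace class operators: ideal property and trace -/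

section TraceClass

variable {H : Type*} [NormedAddCommGroup H] [InnerProductSpace ℂ H] [CompleteSpace H]
  {K : Type*} [NormedAddCommGroup K] [InnerProductSpace ℂ K] [CompleteSpace K]

/-- A compact operator is trace class as soon as its matrix entries with respect to any pair of
orthonormal families are summable along the diagonal. -/
theorem IsTraceClass.of_summable_norm_inner {H : Type u} [NormedAddCommGroup H]
    [InnerProductSpace ℂ H] [CompleteSpace H] {A : H →L[ℂ] H} (hA : IsCompactOperator A)
    (h : ∀ (ι : Type u) (u v : ι → H), Orthonormal ℂ u → Orthonormal ℂ v →
      Summable fun i => ‖⟪u i, A (v i)⟫_ℂ‖) : IsTraceClass A := by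
  set T : H →L[ℂ] H := (ContinuousLinearMap.adjoint A).comp A with hTdef
  have hT : IsCompactOperator T := hA.clm_comp (ContinuousLinearMap.adjoint A)
  have hT' : (T : H →ₗ[ℂ] H).IsSymmetric := fun x y => by
    simp [hTdef, ContinuousLinearMap.adjoint_inner_left, ContinuousLinearMap.adjoint_inner_right]
  obtain ⟨w, b, hb⟩ := hT.exists_hilbertBasis_eigenvectors hT'
  choose c hc using hb
  have hAA (i j : w) : ⟪A (b i), A (b j)⟫_ℂ = c j * ⟪b i, b j⟫_ℂ := by
    rw [← ContinuousLinearMap.adjoint_inner_right, ← inner_smul_right, ← hc]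
    rfl
  have hnorm (i : w) : ((‖A (b i)‖ ^ 2 : ℝ) : ℂ) = c i := by
    have h1 := hAA i i
    rw [inner_self_eq_norm_sq_to_K, inner_self_eq_norm_sq_to_K, b.orthonormal.1 i] at h1
    simpa using h1
  refine ⟨hA, w, b, fun i => ‖A (b i)‖, fun i => norm_nonneg _, fun i => ?_, ?_⟩
  · rw [hnorm, ← hc]
    rfl
  -- As in the polar decomposition, the normalized nonzero images `A bᵢ` are orthonormal, and
  -- pairing them with `A bᵢ` gives exactly the singular values `‖A bᵢ‖`.
  · let ι := {i : w // ‖A (b i)‖ ≠ 0}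
    have hu : Orthonormal ℂ fun i : ι => ((‖A (b i)‖ : ℂ)⁻¹) • A (b i) := by
      refine ⟨fun i => ?_, fun i j hij => ?_⟩
      · rw [norm_smul, norm_inv, Complex.norm_real, norm_norm, inv_mul_cancel₀ i.2]
      · change ⟪_, _⟫_ℂ = 0
        rw [inner_smul_left, inner_smul_right, hAA,
          b.orthonormal.2 fun h => hij (Subtype.ext h)]
        simp
    have hv : Orthonormal ℂ fun i : ι => b i := b.orthonormal.comp _ Subtype.val_injective
    have hs := h ι _ _ hu hv
    rw [← (Subtype.val_injective (p := fun i : w => ‖A (b i)‖ ≠ 0)).summable_iff]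
    · refine hs.congr fun i => ?_
      have hi : (‖A (b i)‖ : ℂ) ≠ 0 := Complex.ofReal_ne_zero.2 i.2
      rw [inner_smul_left, inner_self_eq_norm_sq_to_K]
      simp only [map_inv₀, Complex.conj_ofReal, Complex.coe_algebraMap, pow_two]
      rw [inv_mul_cancel_left₀ hi, Complex.norm_real, norm_norm]
      rfl
    · intro i hi
      by_contra h0
      exact hi ⟨⟨i, h0⟩, rfl⟩

/-- A trace class operator has an orthonormal basis whose images are absolutely summable. -/
theorem IsTraceClass.exists_summable_norm {A : H →L[ℂ] H} (hA : IsTraceClass A) :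
    ∃ (w : Set H) (b : HilbertBasis w ℂ H), Summable fun k => ‖A (b k)‖ := by
  obtain ⟨-, w, b, s, hs, hb, hsum⟩ := hA
  refine ⟨w, b, hsum.congr fun k => ?_⟩
  have h1 : ⟪A (b k), A (b k)⟫_ℂ = ((s k ^ 2 : ℝ) : ℂ) * ⟪b k, b k⟫_ℂ := by
    rw [← ContinuousLinearMap.adjoint_inner_right, hb, inner_smul_right]
  rw [inner_self_eq_norm_sq_to_K, inner_self_eq_norm_sq_to_K, b.orthonormal.1 k] at h1
  have h2 : ‖A (b k)‖ ^ 2 = s k ^ 2 := by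
    have h3 : (‖A (b k)‖ : ℂ) ^ 2 = (s k : ℂ) ^ 2 := by simpa using h1
    exact_mod_cast h3
  exact ((pow_left_inj₀ (norm_nonneg _) (hs k) two_ne_zero).1 h2).symm

/-- Absolute summability of the expansion of `⟪U (u i), A (V (v i))⟫` along `b`. -/
theorem Summable.prod_norm_inner_mul_norm_inner {κ ι : Type*} {A : K →L[ℂ] K}
    {b : HilbertBasis κ ℂ K} (hb : Summable fun k => ‖A (b k)‖) (U V : H →L[ℂ] K) {u v : ι → H}
    (hu : Orthonormal ℂ u) (hv : Orthonormal ℂ v) :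
    Summable fun p : κ × ι => ‖⟪b p.1, V (v p.2)⟫_ℂ * ⟪U (u p.2), A (b p.1)⟫_ℂ‖ := by
  -- With `U`, `V` moved to the other side, the sum over `i` is at most `‖V* bₖ‖ * ‖U* A bₖ‖`, hence
  -- at most a constant times `‖A bₖ‖`.
  have key (k : κ) : (fun i => ‖⟪b k, V (v i)⟫_ℂ * ⟪U (u i), A (b k)⟫_ℂ‖) =
      fun i => ‖⟪v i, ContinuousLinearMap.adjoint V (b k)⟫_ℂ‖ *
        ‖⟪u i, ContinuousLinearMap.adjoint U (A (b k))⟫_ℂ‖ := by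
    ext i
    rw [norm_mul, norm_inner_symm (b k), ContinuousLinearMap.adjoint_inner_right,
      ContinuousLinearMap.adjoint_inner_right]
  refine (summable_prod_of_nonneg fun _ => norm_nonneg _).2 ⟨fun k => ?_, ?_⟩
  · exact (key k) ▸ hu.summable_norm_inner_mul_norm_inner hv _ _
  · refine Summable.of_nonneg_of_le (fun k => tsum_nonneg fun _ => norm_nonneg _) (fun k => ?_)
      (hb.mul_left (‖ContinuousLinearMap.adjoint V‖ * ‖ContinuousLinearMap.adjoint U‖))
    refine ((key k) ▸ hu.tsum_norm_inner_mul_norm_inner_le hv _ _).trans ?_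
    calc _ ≤ (‖ContinuousLinearMap.adjoint V‖ * ‖b k‖) *
          (‖ContinuousLinearMap.adjoint U‖ * ‖A (b k)‖) := by
          gcongr <;> exact ContinuousLinearMap.le_opNorm _ _
      _ = _ := by rw [b.orthonormal.1 k]; ring

/-- Parseval's identity for `A* y` and `x`. -/
theorem HilbertBasis.hasSum_inner_mul_inner_apply {κ : Type*} (b : HilbertBasis κ ℂ K)
    (A : K →L[ℂ] K) (x y : K) :
    HasSum (fun k => ⟪b k, x⟫_ℂ * ⟪y, A (b k)⟫_ℂ) ⟪y, A x⟫_ℂ := by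
  have h := b.hasSum_inner_mul_inner (ContinuousLinearMap.adjoint A y) x
  simp only [ContinuousLinearMap.adjoint_inner_left] at h
  simpa only [mul_comm] using h

/-- Trace class operators form an ideal: compressing a trace class operator by bounded operators
gives a trace class operator. -/
theorem IsTraceClass.adjoint_comp_comp {A : K →L[ℂ] K} (hA : IsTraceClass A)
    (U V : H →L[ℂ] K) :
    IsTraceClass ((ContinuousLinearMap.adjoint U).comp (A.comp V)) := by
  refine .of_summable_norm_inner ((hA.1.comp_clm V).clm_comp
    (ContinuousLinearMap.adjoint U)) fun ι u v hu hv => ?_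
  obtain ⟨w, b, hb⟩ := hA.exists_summable_norm
  have hs := hb.prod_norm_inner_mul_norm_inner U V hu hv
  have hs' := hs.prod_symm
  refine Summable.of_nonneg_of_le (fun i => norm_nonneg _) (fun i => ?_) hs'.prod
  have h := (b.hasSum_inner_mul_inner_apply A (V (v i)) (U (u i))).tsum_eq
  simp only [ContinuousLinearMap.comp_apply, ContinuousLinearMap.adjoint_inner_right]
  rw [← h]
  exact norm_tsum_le_tsum_norm (hs'.prod_factor i)

theorem IsTraceClass.const_smul {A : H →L[ℂ] H} (hA : IsTraceClass A) (c : ℂ) :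
    IsTraceClass (c • A) := by
  obtain ⟨hc, w, b, s, hs, hb, hsum⟩ := hA
  refine ⟨hc.smul c, w, b, fun i => ‖c‖ * s i, fun i => mul_nonneg (norm_nonneg _) (hs i),
    fun i => ?_, hsum.mul_left _⟩
  rw [map_smulₛₗ, _root_.smul_apply, _root_.smul_apply, map_smul, hb,
    smul_smul, smul_smul]
  congr 1
  rw [mul_pow, Complex.ofReal_mul, Complex.ofReal_pow ‖c‖, ← Complex.conj_mul']

theorem isTraceClass_zero : IsTraceClass (0 : H →L[ℂ] H) := by
  obtain ⟨w, b, -⟩ := exists_hilbertBasis ℂ H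
  exact ⟨isCompactOperator_zero, w, b, 0, by simp, by simp, summable_zero⟩

theorem HasTrace.operatorTrace_eq {A : H →L[ℂ] H} {c : ℂ} (h : HasTrace A c) :
    operatorTrace A = c := by
  have hex : ∃ c, HasTrace A c := ⟨c, h⟩
  obtain ⟨w, b, -⟩ := exists_hilbertBasis ℂ H
  rw [operatorTrace, dif_pos hex]
  exact (hex.choose_spec w b).unique (h w b)

theorem operatorTrace_zero : operatorTrace (0 : H →L[ℂ] H) = 0 :=
  HasTrace.operatorTrace_eq fun w e => by simp

/-- The diagonal of a trace class operator is summable, with a sum independent of the basis. -/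
theorem IsTraceClass.hasTrace_operatorTrace {A : H →L[ℂ] H} (hA : IsTraceClass A) :
    HasTrace A (operatorTrace A) := by
  obtain ⟨w, b, hb⟩ := hA.exists_summable_norm
  suffices h : HasTrace A (∑' k, ⟪b k, A (b k)⟫_ℂ) by rwa [h.operatorTrace_eq]
  intro w' e
  -- The double series of `⟪bₖ, eᵢ⟫ * ⟪eᵢ, A bₖ⟫` converges absolutely; summing over `i` first gives
  -- the trace along `b`, over `k` first the trace along `e`.
  have hs := (hb.prod_norm_inner_mul_norm_inner (.id ℂ H) (.id ℂ H) e.orthonormal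
    e.orthonormal).of_norm
  simp only [ContinuousLinearMap.id_apply] at hs
  have h1 := hs.hasSum.prod_fiberwise fun k =>
    e.hasSum_inner_mul_inner (b k) (A (b k))
  rw [h1.tsum_eq]
  have h2 := (Equiv.prodComm w' w).hasSum_iff.2 hs.hasSum
  exact h2.prod_fiberwise fun i => b.hasSum_inner_mul_inner_apply A (e i) (e i)

end TraceClass

/-! ### Simple tensors and matrix entries -/

section SimpleTensor

variable {H₁ H₂ : Type*} [NormedAddCommGroup H₁] [InnerProductSpace ℂ H₁]
  [NormedAddCommGroup H₂] [InnerProductSpace ℂ H₂]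

theorem inner_simpleTensor (x x' : H₁) (y y' : H₂) :
    ⟪simpleTensor x y, simpleTensor x' y'⟫_ℂ = ⟪x, x'⟫_ℂ * ⟪y, y'⟫_ℂ := by
  simp [simpleTensor]

theorem tensorOperator_simpleTensor (S : H₁ →L[ℂ] H₁) (T : H₂ →L[ℂ] H₂) (x : H₁) (y : H₂) :
    tensorOperator S T (simpleTensor x y) = simpleTensor (S x) (T y) := by
  simp [tensorOperator, simpleTensor, ContinuousLinearMap.completion_apply_coe]

/-- The bounded operator `x ↦ x ⊗ y`. -/
noncomputable def simpleTensorLeft (y : H₂) : H₁ →L[ℂ] HilbertTensor H₁ H₂ :=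
  Completion.toComplL.comp ((TensorProduct.mkL ℂ H₁ H₂).flip y)

/-- The bounded operator `y ↦ x ⊗ y`. -/
noncomputable def simpleTensorRight (x : H₁) : H₂ →L[ℂ] HilbertTensor H₁ H₂ :=
  Completion.toComplL.comp (TensorProduct.mkL ℂ H₁ H₂ x)

theorem simpleTensorLeft_apply (x : H₁) (y : H₂) :
    simpleTensorLeft y x = simpleTensor x y := rfl

theorem simpleTensorRight_apply (x : H₁) (y : H₂) :
    simpleTensorRight x y = simpleTensor x y := rfl

/-- A bounded operator on the tensor product is determined by its matrix entries at simple
tensors. -/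
theorem HilbertTensor.ext_inner_simpleTensor
    {A B : HilbertTensor H₁ H₂ →L[ℂ] HilbertTensor H₁ H₂}
    (h : ∀ f₁ f₂ g₁ g₂, ⟪simpleTensor g₁ g₂, A (simpleTensor f₁ f₂)⟫_ℂ =
      ⟪simpleTensor g₁ g₂, B (simpleTensor f₁ f₂)⟫_ℂ) : A = B := by
  -- Only additivity is asked for, so the same argument covers the conjugate-linear slot of the
  -- inner product.
  have hext {C D : HilbertTensor H₁ H₂ → ℂ} (hC : Continuous C) (hD : Continuous D)
      (hCadd : ∀ x y, C (x + y) = C x + C y) (hDadd : ∀ x y, D (x + y) = D x + D y)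
      (hC0 : C 0 = 0) (hD0 : D 0 = 0)
      (hCD : ∀ x y, C (simpleTensor x y) = D (simpleTensor x y)) (z : HilbertTensor H₁ H₂) :
      C z = D z := by
    refine Completion.induction_on z (isClosed_eq hC hD) fun a => ?_
    induction a using TensorProduct.induction_on with
    | zero => rw [Completion.coe_zero, hC0, hD0]
    | tmul x y => exact hCD x y
    | add a b ha hb => rw [Completion.coe_add, hCadd, hDadd, ha, hb]
  ext z
  refine ext_inner_left ℂ fun g => ?_
  refine hext (C := fun g => ⟪g, A z⟫_ℂ) (D := fun g => ⟪g, B z⟫_ℂ) (by fun_prop) (by fun_prop)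
    (fun _ _ => inner_add_left _ _ _) (fun _ _ => inner_add_left _ _ _) (by simp) (by simp)
    (fun g₁ g₂ => ?_) g
  exact hext (C := fun z => ⟪simpleTensor g₁ g₂, A z⟫_ℂ)
    (D := fun z => ⟪simpleTensor g₁ g₂, B z⟫_ℂ) (by fun_prop) (by fun_prop)
    (fun _ _ => by simp [inner_add_right]) (fun _ _ => by simp [inner_add_right]) (by simp)
    (by simp) (fun f₁ f₂ => h f₁ f₂ g₁ g₂) z

/-- The weak integrand of a tensor product multiplier at simple tensors factorizes. -/
theorem tensorMapping_integrand {X₁ X₂ : Type*} (m₁ : X₁ → ℂ) (m₂ : X₂ → ℂ) (F₁ G₁ : X₁ → H₁) (F₂ G₂ : X₂ → H₂)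
    (f₁ g₁ : H₁) (f₂ g₂ : H₂) :
    (fun x : X₁ × X₂ => m₁ x.1 * m₂ x.2 * ⟪tensorMapping F₁ F₂ x, simpleTensor f₁ f₂⟫_ℂ *
      ⟪simpleTensor g₁ g₂, tensorMapping G₁ G₂ x⟫_ℂ) =
    fun x => (m₁ x.1 * ⟪F₁ x.1, f₁⟫_ℂ * ⟪g₁, G₁ x.1⟫_ℂ) *
      (m₂ x.2 * ⟪F₂ x.2, f₂⟫_ℂ * ⟪g₂, G₂ x.2⟫_ℂ) := by
  ext x
  simp only [tensorMapping, inner_simpleTensor]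
  ring

end SimpleTensor

/-! ### Integrability of the factors of a product function -/

section Product

variable {X Y : Type*} [MeasurableSpace X] [MeasurableSpace Y] {μ : Measure X} {ν : Measure Y}
  [SFinite μ] [SFinite ν]

/-- Almost every section is integrable and `g` is nonzero on a non-null set, so some section is a
nonzero multiple of `f`. -/
theorem MeasureTheory.Integrable.of_mul_prod_left {f : X → ℂ} {g : Y → ℂ}
    (h : Integrable (fun p : X × Y => f p.1 * g p.2) (μ.prod ν)) (hg : ∫ y, g y ∂ν ≠ 0) :
    Integrable f μ := by
  have hne : ∃ᵐ y ∂ν, g y ≠ 0 := fun h0 => hg <| integral_eq_zero_of_ae <| by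
    filter_upwards [h0] with y hy using not_not.1 hy
  obtain ⟨y, hy, hint⟩ := (hne.and_eventually h.prod_left_ae).exists
  exact (integrable_mul_const_iff (IsUnit.mk0 _ hy) f).1 hint

theorem MeasureTheory.Integrable.of_mul_prod_right {f : X → ℂ} {g : Y → ℂ}
    (h : Integrable (fun p : X × Y => f p.1 * g p.2) (μ.prod ν)) (hf : ∫ x, f x ∂μ ≠ 0) :
    Integrable g ν := by
  have h' : Integrable (fun p : Y × X => g p.1 * f p.2) (ν.prod μ) := by
    simpa only [Function.comp_def, Prod.fst_swap, Prod.snd_swap, mul_comm] using h.swap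
  exact h'.of_mul_prod_left hf

end Product

/-! ### Scaling of multipliers -/

section Multiplier

variable {X H : Type*} [MeasurableSpace X] [NormedAddCommGroup H] [InnerProductSpace ℂ H]
  {μ : Measure X} {m : X → ℂ} {F G : X → H} {M : H →L[ℂ] H}

theorem IsWeaklyGivenBy.const_smul (h : IsWeaklyGivenBy μ m F G M) (c : ℂ) :
    IsWeaklyGivenBy μ (fun x => c * m x) F G (c • M) := fun f g => by
  obtain ⟨h1, h2⟩ := h f g
  simp only [mul_assoc] at h1 h2 ⊢
  exact ⟨h1.const_mul c, by
    rw [_root_.smul_apply, inner_smul_right, h2, integral_const_mul]⟩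

theorem IsBesselMultiplier.const_smul (h : IsBesselMultiplier μ m F G M) (c : ℂ) :
    IsBesselMultiplier μ (fun x => c * m x) F G (c • M) :=
  ⟨h.1.const_mul c, h.2, h.3, h.4.const_smul c⟩

theorem IsBesselMultiplier.isFrameMultiplier (h : IsBesselMultiplier μ m F G M)
    (hF : IsContinuousFrame μ F) (hG : IsContinuousFrame μ G) : IsFrameMultiplier μ m F G M :=
  ⟨h.1, hF, hG, h.4⟩

end Multiplier

/-! ### Factorization of tensor product multipliers -/

section TensorMultiplier

variable {X₁ X₂ H₁ H₂ : Type*} [MeasurableSpace X₁] [MeasurableSpace X₂]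
  {μ₁ : Measure X₁} {μ₂ : Measure X₂}
  [NormedAddCommGroup H₁] [InnerProductSpace ℂ H₁] [NormedAddCommGroup H₂] [InnerProductSpace ℂ H₂]
  {m₁ : X₁ → ℂ} {m₂ : X₂ → ℂ} {F₁ G₁ : X₁ → H₁} {F₂ G₂ : X₂ → H₂}
  {M : HilbertTensor H₁ H₂ →L[ℂ] HilbertTensor H₁ H₂}

theorem IsWeaklyGivenBy.integrable_tensor
    (hM : IsWeaklyGivenBy (μ₁.prod μ₂) (fun x => m₁ x.1 * m₂ x.2)
      (tensorMapping F₁ F₂) (tensorMapping G₁ G₂) M) (f₁ g₁ : H₁) (f₂ g₂ : H₂) :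
    Integrable (fun x : X₁ × X₂ => (m₁ x.1 * ⟪F₁ x.1, f₁⟫_ℂ * ⟪g₁, G₁ x.1⟫_ℂ) *
      (m₂ x.2 * ⟪F₂ x.2, f₂⟫_ℂ * ⟪g₂, G₂ x.2⟫_ℂ)) (μ₁.prod μ₂) := by
  have h := (hM (simpleTensor f₁ f₂) (simpleTensor g₁ g₂)).1
  rwa [tensorMapping_integrand] at h

variable [SFinite μ₁] [SFinite μ₂]

/-- The factors need not be integrable here: `integral_prod_mul` holds with divergent integrals read
as `0`, so the formula is available before `M₁` and `M₂` are known to exist. -/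
theorem IsWeaklyGivenBy.inner_tensor
    (hM : IsWeaklyGivenBy (μ₁.prod μ₂) (fun x => m₁ x.1 * m₂ x.2)
      (tensorMapping F₁ F₂) (tensorMapping G₁ G₂) M) (f₁ g₁ : H₁) (f₂ g₂ : H₂) :
    ⟪simpleTensor g₁ g₂, M (simpleTensor f₁ f₂)⟫_ℂ =
      (∫ x, m₁ x * ⟪F₁ x, f₁⟫_ℂ * ⟪g₁, G₁ x⟫_ℂ ∂μ₁) *
        ∫ x, m₂ x * ⟪F₂ x, f₂⟫_ℂ * ⟪g₂, G₂ x⟫_ℂ ∂μ₂ := by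
  have h := (hM (simpleTensor f₁ f₂) (simpleTensor g₁ g₂)).2
  rw [tensorMapping_integrand] at h
  exact h.trans (integral_prod_mul (fun x => m₁ x * ⟪F₁ x, f₁⟫_ℂ * ⟪g₁, G₁ x⟫_ℂ)
    fun x => m₂ x * ⟪F₂ x, f₂⟫_ℂ * ⟪g₂, G₂ x⟫_ℂ)

theorem IsWeaklyGivenBy.eq_tensorOperator
    (hM : IsWeaklyGivenBy (μ₁.prod μ₂) (fun x => m₁ x.1 * m₂ x.2)
      (tensorMapping F₁ F₂) (tensorMapping G₁ G₂) M)
    {M₁ : H₁ →L[ℂ] H₁} {M₂ : H₂ →L[ℂ] H₂} (hM₁ : IsWeaklyGivenBy μ₁ m₁ F₁ G₁ M₁)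
    (hM₂ : IsWeaklyGivenBy μ₂ m₂ F₂ G₂ M₂) : M = tensorOperator M₁ M₂ :=
  HilbertTensor.ext_inner_simpleTensor fun f₁ f₂ g₁ g₂ => by
    rw [hM.inner_tensor, tensorOperator_simpleTensor, inner_simpleTensor, (hM₁ f₁ g₁).2,
      (hM₂ f₂ g₂).2]

variable [CompleteSpace H₁] [CompleteSpace H₂]

/-- If a tensor product multiplier is nonzero and trace class, then both factor multipliers exist
and are trace class. -/
theorem IsWeaklyGivenBy.exists_factors
    (hM : IsWeaklyGivenBy (μ₁.prod μ₂) (fun x => m₁ x.1 * m₂ x.2)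
      (tensorMapping F₁ F₂) (tensorMapping G₁ G₂) M) (hMtc : IsTraceClass M) (h0 : M ≠ 0) :
    (∃ M₁ : H₁ →L[ℂ] H₁, IsWeaklyGivenBy μ₁ m₁ F₁ G₁ M₁ ∧ IsTraceClass M₁) ∧
      ∃ M₂ : H₂ →L[ℂ] H₂, IsWeaklyGivenBy μ₂ m₂ F₂ G₂ M₂ ∧ IsTraceClass M₂ := by
  obtain ⟨f₁, f₂, g₁, g₂, hne⟩ : ∃ f₁ f₂ g₁ g₂,
      ⟪simpleTensor g₁ g₂, M (simpleTensor f₁ f₂)⟫_ℂ ≠ 0 := by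
    by_contra! h
    exact h0 (HilbertTensor.ext_inner_simpleTensor fun f₁ f₂ g₁ g₂ => by simp [h f₁ f₂ g₁ g₂])
  rw [hM.inner_tensor] at hne
  have hne₁ := left_ne_zero_of_mul hne
  have hne₂ := right_ne_zero_of_mul hne
  -- Each witness is a compression of `M`, divided by the nonzero integral of the frozen factor.
  refine ⟨⟨_, fun f g => ⟨(hM.integrable_tensor f g f₂ g₂).of_mul_prod_left hne₂, ?_⟩,
    (hMtc.adjoint_comp_comp (simpleTensorLeft g₂) (simpleTensorLeft f₂)).const_smul
      (∫ x, m₂ x * ⟪F₂ x, f₂⟫_ℂ * ⟪g₂, G₂ x⟫_ℂ ∂μ₂)⁻¹⟩,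
    ⟨_, fun f g => ⟨(hM.integrable_tensor f₁ g₁ f g).of_mul_prod_right hne₁, ?_⟩,
    (hMtc.adjoint_comp_comp (simpleTensorRight g₁) (simpleTensorRight f₁)).const_smul
      (∫ x, m₁ x * ⟪F₁ x, f₁⟫_ℂ * ⟪g₁, G₁ x⟫_ℂ ∂μ₁)⁻¹⟩⟩
  · rw [_root_.smul_apply, inner_smul_right, ContinuousLinearMap.comp_apply,
      ContinuousLinearMap.adjoint_inner_right, ContinuousLinearMap.comp_apply,
      simpleTensorLeft_apply, simpleTensorLeft_apply, hM.inner_tensor, mul_comm,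
      mul_inv_cancel_right₀ hne₂]
  · rw [_root_.smul_apply, inner_smul_right, ContinuousLinearMap.comp_apply,
      ContinuousLinearMap.adjoint_inner_right, ContinuousLinearMap.comp_apply,
      simpleTensorRight_apply, simpleTensorRight_apply, hM.inner_tensor,
      inv_mul_cancel_left₀ hne₁]

end TensorMultiplier

/-! ### Trace class and partial traces of `S ⊗ T` -/

section TensorOperator

variable {H₁ H₂ : Type*} [NormedAddCommGroup H₁] [InnerProductSpace ℂ H₁]
  [NormedAddCommGroup H₂] [InnerProductSpace ℂ H₂]
  {S : H₁ →L[ℂ] H₁} {T : H₂ →L[ℂ] H₂}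

theorem ContinuousLinearMap.exists_inner_ne_zero {H : Type*} [NormedAddCommGroup H]
    [InnerProductSpace ℂ H] {S : H →L[ℂ] H} (hS : S ≠ 0) : ∃ f g, ⟪g, S f⟫_ℂ ≠ 0 := by
  obtain ⟨f, hf⟩ := DFunLike.ne_iff.1 hS
  exact ⟨f, S f, inner_self_ne_zero.2 hf⟩

theorem IsTraceClass.of_tensorOperator_right [CompleteSpace H₂] (h : IsTraceClass (tensorOperator S T))
    (hS : S ≠ 0) : IsTraceClass T := by
  obtain ⟨f, g, hfg⟩ := S.exists_inner_ne_zero hS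
  convert! (h.adjoint_comp_comp (simpleTensorRight g) (simpleTensorRight f)).const_smul
    (⟪g, S f⟫_ℂ)⁻¹
  ext x
  refine ext_inner_left ℂ fun y => ?_
  rw [_root_.smul_apply, inner_smul_right, ContinuousLinearMap.comp_apply,
    ContinuousLinearMap.adjoint_inner_right, ContinuousLinearMap.comp_apply,
    simpleTensorRight_apply, simpleTensorRight_apply, tensorOperator_simpleTensor,
    inner_simpleTensor, inv_mul_cancel_left₀ hfg]

theorem IsTraceClass.of_tensorOperator_left [CompleteSpace H₁] (h : IsTraceClass (tensorOperator S T))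
    (hT : T ≠ 0) : IsTraceClass S := by
  obtain ⟨f, g, hfg⟩ := T.exists_inner_ne_zero hT
  convert! (h.adjoint_comp_comp (simpleTensorLeft g) (simpleTensorLeft f)).const_smul
    (⟪g, T f⟫_ℂ)⁻¹
  ext x
  refine ext_inner_left ℂ fun y => ?_
  rw [_root_.smul_apply, inner_smul_right, ContinuousLinearMap.comp_apply,
    ContinuousLinearMap.adjoint_inner_right, ContinuousLinearMap.comp_apply,
    simpleTensorLeft_apply, simpleTensorLeft_apply, tensorOperator_simpleTensor,
    inner_simpleTensor, mul_comm, mul_inv_cancel_right₀ hfg]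

/-- If `S = 0`, every term vanishes, whatever value `operatorTrace T` takes. -/
theorem isPartialTraceFst_tensorOperator [CompleteSpace H₂] (h : S ≠ 0 → IsTraceClass T) :
    IsPartialTraceFst (tensorOperator S T) (operatorTrace T • S) := by
  intro w e f g
  simp only [tensorOperator_simpleTensor, inner_simpleTensor, _root_.smul_apply,
    inner_smul_right]
  by_cases hS : S = 0
  · simp [hS]
  · rw [mul_comm]
    exact ((h hS).hasTrace_operatorTrace w e).mul_left _

theorem isPartialTraceSnd_tensorOperator [CompleteSpace H₁] (h : T ≠ 0 → IsTraceClass S) :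
    IsPartialTraceSnd (tensorOperator S T) (operatorTrace S • T) := by
  intro w e f g
  simp only [tensorOperator_simpleTensor, inner_simpleTensor, _root_.smul_apply,
    inner_smul_right]
  by_cases hT : T = 0
  · simp [hT]
  · exact ((h hT).hasTrace_operatorTrace w e).mul_right _

/-- For `T = 0` the operator `S` may fail to be trace class, but then the scalar is `0`. -/
theorem isTraceClass_operatorTrace_smul [CompleteSpace H₁] [CompleteSpace H₂]
    (h : T ≠ 0 → IsTraceClass S) :
    IsTraceClass (operatorTrace T • S) := by
  by_cases hT : T = 0
  · rw [hT, operatorTrace_zero, zero_smul]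
    exact isTraceClass_zero
  · exact (h hT).const_smul _

end TensorOperator

theorem corollary5p7
    {X₁ X₂ H₁ H₂ : Type*} [MeasurableSpace X₁] [MeasurableSpace X₂]
    (μ₁ : Measure X₁) (μ₂ : Measure X₂) [SigmaFinite μ₁] [SigmaFinite μ₂]
    [NormedAddCommGroup H₁] [InnerProductSpace ℂ H₁] [CompleteSpace H₁]
    [TopologicalSpace.SeparableSpace H₁]
    [NormedAddCommGroup H₂] [InnerProductSpace ℂ H₂] [CompleteSpace H₂]
    [TopologicalSpace.SeparableSpace H₂]
    (m₁ : X₁ → ℂ) (m₂ : X₂ → ℂ) (hm₁ : Measurable m₁) (hm₂ : Measurable m₂)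
    (F₁ G₁ : X₁ → H₁) (F₂ G₂ : X₂ → H₂)
    (hF₁ : IsBesselMapping μ₁ F₁) (hG₁ : IsBesselMapping μ₁ G₁)
    (hF₂ : IsBesselMapping μ₂ F₂) (hG₂ : IsBesselMapping μ₂ G₂)
    (M : HilbertTensor H₁ H₂ →L[ℂ] HilbertTensor H₁ H₂)
    (hM : IsWeaklyGivenBy (μ₁.prod μ₂) (fun x => m₁ x.1 * m₂ x.2)
      (tensorMapping F₁ F₂) (tensorMapping G₁ G₂) M)
    (hMtc : IsTraceClass M) :
    -- if `M ≠ 0`, both factor multipliers exist and are trace class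
    (M ≠ 0 → ∃ (M₁ : H₁ →L[ℂ] H₁) (M₂ : H₂ →L[ℂ] H₂),
      IsBesselMultiplier μ₁ m₁ F₁ G₁ M₁ ∧ IsBesselMultiplier μ₂ m₂ F₂ G₂ M₂ ∧
      IsTraceClass M₁ ∧ IsTraceClass M₂) ∧
    -- whenever both factor multipliers exist, the partial traces are as claimed
    ∀ (M₁ : H₁ →L[ℂ] H₁) (M₂ : H₂ →L[ℂ] H₂),
      IsBesselMultiplier μ₁ m₁ F₁ G₁ M₁ → IsBesselMultiplier μ₂ m₂ F₂ G₂ M₂ →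
      M = tensorOperator M₁ M₂ ∧
      -- with respect to `H₁`
      ((M₁ ≠ 0 → IsTraceClass M₂) ∧
        IsPartialTraceFst M (operatorTrace M₂ • M₁) ∧
        IsTraceClass (operatorTrace M₂ • M₁) ∧
        IsBesselMultiplier μ₁ (fun x => operatorTrace M₂ * m₁ x) F₁ G₁ (operatorTrace M₂ • M₁) ∧
        (IsContinuousFrame μ₁ F₁ → IsContinuousFrame μ₁ G₁ →
          IsFrameMultiplier μ₁ (fun x => operatorTrace M₂ * m₁ x) F₁ G₁
            (operatorTrace M₂ • M₁))) ∧
      -- with respect to `H₂`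
      ((M₂ ≠ 0 → IsTraceClass M₁) ∧
        IsPartialTraceSnd M (operatorTrace M₁ • M₂) ∧
        IsTraceClass (operatorTrace M₁ • M₂) ∧
        IsBesselMultiplier μ₂ (fun x => operatorTrace M₁ * m₂ x) F₂ G₂ (operatorTrace M₁ • M₂) ∧
        (IsContinuousFrame μ₂ F₂ → IsContinuousFrame μ₂ G₂ →
          IsFrameMultiplier μ₂ (fun x => operatorTrace M₁ * m₂ x) F₂ G₂
            (operatorTrace M₁ • M₂))) := by
  refine ⟨fun h0 => ?_, fun M₁ M₂ h₁ h₂ => ?_⟩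
  · obtain ⟨⟨M₁, h₁, htc₁⟩, M₂, h₂, htc₂⟩ := hM.exists_factors hMtc h0
    exact ⟨M₁, M₂, ⟨hm₁, hF₁, hG₁, h₁⟩, ⟨hm₂, hF₂, hG₂, h₂⟩, htc₁, htc₂⟩
  · have hMeq := hM.eq_tensorOperator h₁.weaklyGivenBy h₂.weaklyGivenBy
    subst hMeq
    have htc₁ := fun h => hMtc.of_tensorOperator_left (S := M₁) (T := M₂) h
    have htc₂ := fun h => hMtc.of_tensorOperator_right (S := M₁) (T := M₂) h
    exact ⟨rfl,
      ⟨htc₂, isPartialTraceFst_tensorOperator htc₂, isTraceClass_operatorTrace_smul htc₁,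
        h₁.const_smul _, (h₁.const_smul _).isFrameMultiplier⟩,
      ⟨htc₁, isPartialTraceSnd_tensorOperator htc₁, isTraceClass_operatorTrace_smul htc₂,
        h₂.const_smul _, (h₂.const_smul _).isFrameMultiplier⟩⟩
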